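/- **Adapted Orthogonal Subspace Game.** The parameters are integers $1\le\tilde d\le d$, $M,k,m\ge 0$, $J\ge 1$ and reals $\beta,\gamma$. (1) The oracle samples a uniform $\tilde d$-dimensional linear subspace $E\subset\mathbb{R}^d$ (normalized Haar measure on the Grassmannian) and, given $E$, i.i.d. vectors $v_r^{(j)}$, $r\in[m]$, $j\in[J]$, uniform on the unit sphere of $E$. (2) The player observes $E$ and all the vectors $v_r^{(j)}$; based on these it stores an $M$-bit message $\mathsf{Message}\in\{0,1\}^M$ and chooses an index $\hat\jmath\in[J]$. (3) The oracle sends $v_1^{(\hat\jmath)},\dots,v_m^{(\hat\jmath)}$ to the player. (4) Based on $\mathsf{Message}$ and $v_1^{(\hat\jmath)},\dots,v_m^{(\hat\jmath)}$ only, the player returns unit vectors $y_1,\dots,y_k\in\mathbb{R}^d$. The player may be randomized, and may use the same internal randomness (independent of the oracle's samples) in steps (2) and (4). The player wins if for all $i\in[k]$ $$\|\mathrm{Proj}_E(y_i)\|\le\beta\qquad\text{and}\qquad \|\mathrm{Proj}_{\mathrm{Span}(y_1,\dots,y_{i-1})^\perp}(y_i)\|\ge\gamma .$$ **Theorem.**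 Let $d\ge 8$, $1\le\tilde d\le d$, $J\geq 1$, $C\ge 1$ and $0<\beta,\gamma\le 1$ be such that $\gamma/\beta\ge 3e\sqrt{kd/\tilde d}$. Suppose that $$\frac{\tilde d}{4}\ \ge\ k\ \ge\ 50\,C\,\frac{M+2\log_2 J+3}{\tilde d}\,\ln\frac{\sqrt d}{\gamma}.$$ If some strategy of the player wins the Adapted Orthogonal Subspace Game with probability at least $1/C$, then $m>\tilde d/2$. -/

import Mathlib

open MeasureTheory

noncomputable section

namespace OrthogonalSubspaceGame

/-- The Euclidean space `ℝ^d`. -/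
abbrev Vec (d : ℕ) : Type := EuclideanSpace ℝ (Fin d)

/-! ### The Grassmannian and its normalized Haar measure -/

/-- The Grassmannian of `n`-dimensional linear subspaces of `ℝ^d`. -/
def Gr (d n : ℕ) : Type := {E : Submodule ℝ (Vec d) // Module.finrank ℝ E = n}

/-- The topology of the Grassmannian: a subspace is identified with the orthogonal projection
onto it, and projections are compared in operator norm. -/
instance Gr.instTopologicalSpace (d n : ℕ) : TopologicalSpace (Gr d n) :=
  TopologicalSpace.induced (fun E => E.1.starProjection) inferInstance

instance Gr.instMeasurableSpace (d n : ℕ) : MeasurableSpace (Gr d n) := borel (Gr d n)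

instance Gr.instBorelSpace (d n : ℕ) : BorelSpace (Gr d n) := ⟨rfl⟩

/-- The orthogonal group `O(d)`, as the group of unitary operators of the real Hilbert
space `ℝ^d`. -/
abbrev OrthGroup (d : ℕ) : Type := unitary (Vec d →L[ℝ] Vec d)

instance instContinuousStarOperator (d : ℕ) : ContinuousStar (Vec d →L[ℝ] Vec d) :=
  ⟨(ContinuousLinearMap.adjoint (𝕜 := ℝ) (E := Vec d) (F := Vec d)).continuous⟩

instance OrthGroup.instCompactSpace (d : ℕ) : CompactSpace (OrthGroup d) := by
  have hb : Bornology.IsBounded (unitary (Vec d →L[ℝ] Vec d) : Set (Vec d →L[ℝ] Vec d)) := by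
    refine (Metric.isBounded_iff_subset_closedBall 0).2 ⟨1, fun u hu => ?_⟩
    rw [mem_closedBall_zero_iff]
    refine ContinuousLinearMap.opNorm_le_bound _ zero_le_one fun x => ?_
    have h := (Unitary.linearIsometryEquiv (𝕜 := ℝ) ⟨u, hu⟩).norm_map x
    rw [one_mul]
    exact h.le
  exact isCompact_iff_compactSpace.1
    (Metric.isCompact_of_isClosed_isBounded isClosed_unitary hb)

/-- The Haar probability measure on `O(d)`. -/
def haarOrth (d : ℕ) : Measure (OrthGroup d) := Measure.haarMeasure ⊤

instance haarOrth.instIsProbabilityMeasure (d : ℕ) : IsProbabilityMeasure (haarOrth d) :=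
  ⟨Measure.haarMeasure_self (K₀ := (⊤ : TopologicalSpace.PositiveCompacts (OrthGroup d)))⟩

/-- The image `U(E)` of a subspace `E` under an orthogonal transformation `U`. -/
def rotate {d n : ℕ} (U : OrthGroup d) (E : Gr d n) : Gr d n :=
  ⟨E.1.map (Unitary.linearIsometryEquiv (𝕜 := ℝ) U).toLinearEquiv.toLinearMap, by
    rw [LinearEquiv.finrank_map_eq]; exact E.2⟩

/-- The subspace of `ℝ^d` spanned by the first `n` vectors of the standard basis. -/
def coordSubspace (d n : ℕ) (h : n ≤ d) : Gr d n :=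
  ⟨Submodule.span ℝ (Set.range fun i : Fin n =>
      (EuclideanSpace.basisFun (Fin d) ℝ) (Fin.castLE h i)), by
    rw [finrank_span_eq_card]
    · simp
    · exact (EuclideanSpace.basisFun (Fin d) ℝ).orthonormal.linearIndependent.comp _
        (Fin.castLE_injective h)⟩

/-- The normalized Haar measure of the Grassmannian, i.e. the law of a uniform `n`-dimensional
subspace of `ℝ^d`: the image of the Haar probability measure of `O(d)` under the transitive
action on `n`-dimensional subspaces. -/
def uniformGr (d n : ℕ) (h : n ≤ d) : Measure (Gr d n) :=
  (haarOrth d).map fun U => rotate U (coordSubspace d n h)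

lemma continuous_rotate {d n : ℕ} (E : Gr d n) :
    Continuous fun U : OrthGroup d => rotate U E := by
  refine continuous_induced_rng.2 ?_
  have h : ∀ U : OrthGroup d, (rotate U E).1.starProjection
      = (U : Vec d →L[ℝ] Vec d) * E.1.starProjection * star (U : Vec d →L[ℝ] Vec d) := by
    intro U
    ext1 x
    exact Submodule.starProjection_map_apply (Unitary.linearIsometryEquiv (𝕜 := ℝ) U) E.1 x
  simp only [Function.comp_def, h]
  fun_prop

instance uniformGr.instIsProbabilityMeasure (d n : ℕ) (h : n ≤ d) :
    IsProbabilityMeasure (uniformGr d n h) :=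
  Measure.isProbabilityMeasure_map (continuous_rotate _).measurable.aemeasurable

/-! ### The uniform distribution on the unit sphere of a subspace -/

/-- The uniform probability distribution on the set of unit vectors of the subspace `E`, seen as a
measure on `ℝ^d`: the normalized surface measure of the unit sphere of `E`. -/
def uniformSphere {d : ℕ} (E : Submodule ℝ (Vec d)) : Measure (Vec d) :=
  (((volume : Measure E).toSphere Set.univ)⁻¹ • (volume : Measure E).toSphere).map
    fun x : Metric.sphere (0 : E) 1 => ((x : E) : Vec d)

lemma isProbabilityMeasure_uniformSphere {d n : ℕ} (hn : 1 ≤ n) (E : Gr d n) :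
    IsProbabilityMeasure (uniformSphere E.1) := by
  have : Nontrivial E.1 := Module.nontrivial_of_finrank_pos (R := ℝ) (by rw [E.2]; exact hn)
  have : IsProbabilityMeasure
      (((volume : Measure E.1).toSphere Set.univ)⁻¹ • (volume : Measure E.1).toSphere) := by
    refine ⟨?_⟩
    rw [Measure.smul_apply, smul_eq_mul]
    refine ENNReal.inv_mul_cancel ?_ (measure_ne_top _ _)
    rw [Measure.toSphere_apply_univ]
    refine mul_ne_zero ?_ (Metric.measure_ball_pos _ _ one_pos).ne'
    rw [E.2]
    exact_mod_cast (by lia : n ≠ 0)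
  exact Measure.isProbabilityMeasure_map
    (measurable_subtype_coe.comp measurable_subtype_coe).aemeasurable

/-! ### The Adapted Orthogonal Subspace Game -/

/-- The samples drawn by the oracle: `v j r` is the `r`-th vector of the `j`-th batch. -/
abbrev Samples (d m J : ℕ) : Type := Fin J → Fin m → Vec d

/-- A (randomized) strategy of the player. The player first observes the subspace and all the
samples, and stores an `M`-bit message and the index of a batch. Afterwards it outputs `k` unit
vectors based on the message and on the chosen batch only. Both steps may use the same internal
randomness `ω : Ω`, which is not counted in the message. -/
structure Strategy (Ω : Type*) [MeasurableSpace Ω] (d n M k m J : ℕ) where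
  message : Ω × Gr d n × Samples d m J → (Fin M → Bool)
  index : Ω × Gr d n × Samples d m J → Fin J
  output : Ω × (Fin M → Bool) × (Fin m → Vec d) → (Fin k → Metric.sphere (0 : Vec d) 1)
  measurable_message : Measurable message
  measurable_index : Measurable index
  measurable_output : Measurable output

/-- The winning condition: every `y i` is almost orthogonal to `E` and robustly independent
of `y j`, `j < i`. -/
def Wins {d k : ℕ} (β γ : ℝ) (E : Submodule ℝ (Vec d)) (y : Fin k → Vec d) : Prop :=
  ∀ i : Fin k, ‖E.starProjection (y i)‖ ≤ β ∧
    γ ≤ ‖(Submodule.span ℝ (y '' {j | j < i}))ᗮ.starProjection (y i)‖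

/-- The vectors returned by the player when its randomness is `ω`, the sampled subspace is `E` and
the samples are `v`. -/
def Strategy.play {Ω : Type*} [MeasurableSpace Ω] {d n M k m J : ℕ} (S : Strategy Ω d n M k m J)
    (ω : Ω) (E : Gr d n) (v : Samples d m J) : Fin k → Vec d :=
  fun i => S.output (ω, S.message (ω, E, v), v (S.index (ω, E, v))) i

/-- The probability that the player wins: its randomness has law `ρ`, independently `E` is a
uniform `n`-dimensional subspace of `ℝ^d`, and given `E` the samples are i.i.d. uniform unit vectors
of `E`. -/
def Strategy.winProb {Ω : Type*} [MeasurableSpace Ω] {d n M k m J : ℕ}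
    (S : Strategy Ω d n M k m J) (ρ : Measure Ω) (h : n ≤ d) (β γ : ℝ) : ENNReal :=
  ∫⁻ ω, ∫⁻ E : Gr d n,
      Measure.pi (fun _ : Fin J => Measure.pi fun _ : Fin m => uniformSphere E.1)
        {v | Wins β γ E.1 (S.play ω E v)} ∂(uniformGr d n h) ∂ρ

end OrthogonalSubspaceGame

end

open MeasureTheory

noncomputable section

namespace OrthogonalSubspaceGame

/-! Suppose `m ≤ n / 2`. A union bound over the `J` batches and the `2 ^ M` messages removes all
adaptivity: it suffices to show that a fixed function `g` of one batch wins with probability at most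
`2 ^ (-n k / 8)`, since `J * 2 ^ M * 2 ^ (-n k / 8) < 1 / C` (`mul_two_pow_mul_lt`).

For one batch, write the subspace as `U E` with `U` Haar distributed and the samples as `U w` with
`w` independent of `U`. The samples reveal at most `m` dimensions of `U E`; by invariance under
rotations fixing them, the answer must also be almost orthogonal to a random subspace of dimension
`n - m` independent of the samples (`haarOrth_wins_comp_le`). The answer can then be treated as a
fixed family `y`.

For fixed `y`, the vectors are treated one at a time (`haarOrth_forall_le`). Conditionally on what
happens to the earlier ones, with span `K`, the part of `y i` orthogonal to `K` has norm at least
`γ` and its direction is still uniform in `Kᗮ`. The rotated subspace meets `Kᗮ` in dimension at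
least `n / 4`, so a projection of norm at most `β` has probability at most `2 ^ (-n / 8)`
(`haarOrth_inter_le`). This last bound is a volume estimate for a slab of the unit ball
(`volume_slab_le_rpow`).

The conditioning is done by Fubini and invariance of Haar measure under translation, slice by slice,
so neither conditional laws nor measurable choices of rotations are needed. -/

/-! ### Orthogonal transformations -/

/-- The linear isometry given by an element of the orthogonal group. -/
abbrev iso {d : ℕ} (U : OrthGroup d) : Vec d ≃ₗᵢ[ℝ] Vec d :=
  Unitary.linearIsometryEquiv (𝕜 := ℝ) U

lemma iso_mul_apply {d : ℕ} (U V : OrthGroup d) (x : Vec d) :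
    iso (U * V) x = iso U (iso V x) := by
  simp [iso, map_mul]

lemma iso_inv {d : ℕ} (U : OrthGroup d) : iso U⁻¹ = (iso U).symm := by
  rw [iso, map_inv]; rfl

lemma exists_iso_eq {d : ℕ} (e : Vec d ≃ₗᵢ[ℝ] Vec d) : ∃ U : OrthGroup d, iso U = e :=
  ⟨(Unitary.linearIsometryEquiv (𝕜 := ℝ)).symm e, by simp [iso]⟩

lemma continuous_iso_apply {d : ℕ} :
    Continuous fun p : OrthGroup d × Vec d => iso p.1 p.2 := by
  change Continuous fun p : OrthGroup d × Vec d => (p.1 : Vec d →L[ℝ] Vec d) p.2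
  fun_prop

lemma norm_starProjection_map_iso {d : ℕ} (U : OrthGroup d) (F : Submodule ℝ (Vec d))
    (y : Vec d) :
    ‖(F.map (iso U).toLinearEquiv.toLinearMap).starProjection y‖
      = ‖F.starProjection (iso U⁻¹ y)‖ := by
  rw [Submodule.starProjection_map_apply, LinearIsometryEquiv.norm_map, iso_inv]

lemma norm_starProjection_mono {d : ℕ} {F E : Submodule ℝ (Vec d)} (h : F ≤ E) (y : Vec d) :
    ‖F.starProjection y‖ ≤ ‖E.starProjection y‖ := by
  have : F.starProjection y = F.starProjection (E.starProjection y) := by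
    rw [← ContinuousLinearMap.comp_apply, Submodule.starProjection_comp_starProjection_of_le h]
  rw [this]
  exact F.norm_starProjection_apply_le _

instance haarOrth.instIsHaarMeasure (d : ℕ) : (haarOrth d).IsHaarMeasure := by
  unfold haarOrth; infer_instance

/-- A compact group is unimodular: a right translate of the Haar probability measure is again one,
and this measure is unique. -/
instance haarOrth.instIsMulRightInvariant (d : ℕ) : (haarOrth d).IsMulRightInvariant := by
  refine ⟨fun g => ?_⟩
  have : IsProbabilityMeasure ((haarOrth d).map (· * g)) :=
    Measure.isProbabilityMeasure_map (measurable_mul_const g).aemeasurable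
  exact Measure.isHaarMeasure_eq_of_isProbabilityMeasure _ _

/-! ### The volume of a slab of the unit ball -/

/-- The map preserves `F`, acting as the scalar `a` on `F` and as `b` on the quotient by `F`. -/
lemma det_smul_starProjection_add {d : ℕ} (F : Submodule ℝ (Vec d)) (a b : ℝ) :
    LinearMap.det (a • F.starProjection.toLinearMap + b • Fᗮ.starProjection.toLinearMap)
      = a ^ Module.finrank ℝ F * b ^ (d - Module.finrank ℝ F) := by
  set f := a • F.starProjection.toLinearMap + b • Fᗮ.starProjection.toLinearMap with hf
  have hF : ∀ x ∈ F, f x = a • x := by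
    intro x hx
    have h1 : F.starProjection x = x := Submodule.starProjection_eq_self_iff.2 hx
    have h2 : Fᗮ.starProjection x = 0 := by
      rw [Submodule.starProjection_orthogonal_apply_eq_zero hx]
    simp [hf, h1, h2]
  have hle : F ≤ F.comap f := fun x hx => by
    rw [Submodule.mem_comap, hF x hx]; exact F.smul_mem a hx
  have hres : f.restrict hle = a • LinearMap.id := by
    ext x : 1
    exact Subtype.ext (hF x x.2)
  have hquot : F.mapQ F f hle = b • LinearMap.id := by
    refine Submodule.linearMap_qext _ (LinearMap.ext fun x => ?_)
    have : f x - b • x ∈ F := by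
      have h3 : f x - b • x = (a - b) • F.starProjection x := by
        have := F.starProjection_add_starProjection_orthogonal x
        simp only [hf, LinearMap.add_apply, LinearMap.smul_apply, ContinuousLinearMap.coe_coe]
        nth_rw 3 [← this]
        module
      rw [h3]
      exact F.smul_mem _ (F.starProjection_apply_mem x)
    simpa using (Submodule.Quotient.eq F).2 this
  rw [LinearMap.det_eq_det_mul_det F f hle, hres, hquot, LinearMap.det_smul, LinearMap.det_smul,
    LinearMap.det_id, LinearMap.det_id, mul_one, mul_one, Submodule.finrank_quotient,
    finrank_euclideanSpace_fin]

/-- A slab of the unit ball is mapped into the unit ball by a diagonal linear map. -/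
lemma volume_slab_le {d : ℕ} (F : Submodule ℝ (Vec d)) {t l r : ℝ} (ht : 0 < t) (hl : 0 < l)
    (hr : 0 < r) (hlr : l ^ 2 + r ^ 2 ≤ 1) :
    volume {x : Vec d | ‖x‖ ≤ 1 ∧ ‖F.starProjection x‖ ≤ t} ≤
      ENNReal.ofReal ((t / l) ^ Module.finrank ℝ F * (1 / r) ^ (d - Module.finrank ℝ F)) *
        volume (Metric.closedBall (0 : Vec d) 1) := by
  set f := (l / t) • F.starProjection.toLinearMap + r • Fᗮ.starProjection.toLinearMap with hf
  set s := {x : Vec d | ‖x‖ ≤ 1 ∧ ‖F.starProjection x‖ ≤ t}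
  have hsub : f '' s ⊆ Metric.closedBall (0 : Vec d) 1 := by
    rintro _ ⟨x, ⟨hx1, hx2⟩, rfl⟩
    rw [mem_closedBall_zero_iff, ← sq_le_one_iff₀ (norm_nonneg _)]
    have h0 : f x = (l / t) • F.starProjection x + r • Fᗮ.starProjection x := rfl
    have hin : inner ℝ ((l / t) • F.starProjection x) (r • Fᗮ.starProjection x) = (0 : ℝ) :=
      Submodule.inner_right_of_mem_orthogonal (K := F)
        (F.smul_mem _ (F.starProjection_apply_mem x))
        (Fᗮ.smul_mem _ (Fᗮ.starProjection_apply_mem x))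
    have h1 := norm_add_sq_eq_norm_sq_add_norm_sq_of_inner_eq_zero _ _ hin
    have h2 : ‖Fᗮ.starProjection x‖ ≤ 1 := (Fᗮ.norm_starProjection_apply_le x).trans hx1
    have h3 : ‖(l / t) • F.starProjection x‖ ≤ l := by
      rw [norm_smul, Real.norm_of_nonneg (by positivity)]
      calc l / t * ‖F.starProjection x‖ ≤ l / t * t := by gcongr
        _ = l := by field_simp
    have h4 : ‖r • Fᗮ.starProjection x‖ ≤ r := by
      rw [norm_smul, Real.norm_of_nonneg hr.le]
      exact mul_le_of_le_one_right hr.le h2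
    rw [h0, sq, h1]
    nlinarith [norm_nonneg ((l / t) • F.starProjection x), norm_nonneg (r • Fᗮ.starProjection x)]
  have hdet : 0 < (l / t) ^ Module.finrank ℝ F * r ^ (d - Module.finrank ℝ F) := by positivity
  have key := measure_mono (μ := (volume : Measure (Vec d))) hsub
  rw [Measure.addHaar_image_linearMap, hf, det_smul_starProjection_add, abs_of_pos hdet] at key
  calc volume s = ENNReal.ofReal ((t / l) ^ Module.finrank ℝ F *
        (1 / r) ^ (d - Module.finrank ℝ F)) * (ENNReal.ofReal ((l / t) ^ Module.finrank ℝ F *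
          r ^ (d - Module.finrank ℝ F)) * volume s) := by
        rw [← mul_assoc, ← ENNReal.ofReal_mul (by positivity)]
        have : (t / l) ^ Module.finrank ℝ F * (1 / r) ^ (d - Module.finrank ℝ F) *
          ((l / t) ^ Module.finrank ℝ F * r ^ (d - Module.finrank ℝ F)) = 1 := by
          rw [mul_mul_mul_comm, ← mul_pow, ← mul_pow]
          field_simp
          simp
        rw [this, ENNReal.ofReal_one, one_mul]
    _ ≤ _ := by gcongr

/-- The volume fraction of a slab of half-width `t` around a subspace of codimension `N` in the
unit ball of `ℝ^d`. -/
lemma volume_slab_le_rpow {d n k : ℕ} (F : Submodule ℝ (Vec d)) {t : ℝ} (ht : 0 < t)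
    (hk : 1 ≤ k) (hn : 1 ≤ n) (hnd : n ≤ d) (hF : (n : ℝ) / 4 ≤ Module.finrank ℝ F)
    (htk : 3 * Real.exp 1 * Real.sqrt ((k : ℝ) * d / n) * t ≤ 1) :
    volume {x : Vec d | ‖x‖ ≤ 1 ∧ ‖F.starProjection x‖ ≤ t} ≤
      ENNReal.ofReal ((1 / 2 : ℝ) ^ ((n : ℝ) / 8)) *
        volume (Metric.closedBall (0 : Vec d) 1) := by
  have hNd : Module.finrank ℝ F ≤ d := by simpa using Submodule.finrank_le F
  set N := Module.finrank ℝ F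
  have hn0 : (0 : ℝ) < n := by exact_mod_cast hn
  have hN0 : (0 : ℝ) < N := lt_of_lt_of_le (by positivity) hF
  have hd0 : (0 : ℝ) < d := by exact_mod_cast (by lia : 0 < d)
  have hk1 : (1 : ℝ) ≤ k := by exact_mod_cast hk
  have hNd' : (N : ℝ) ≤ d := by exact_mod_cast hNd
  -- The optimal choice under `l ^ 2 + r ^ 2 = 1` would be `l ^ 2 = N / d`; replacing `d` by `d + N`
  -- keeps `r` positive when `N = d`.
  set l := Real.sqrt (N / (d + N)) with hl
  set r := Real.sqrt (d / (d + N)) with hr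
  have hl2 : l ^ 2 = N / (d + N) := Real.sq_sqrt (by positivity)
  have hr2 : r ^ 2 = d / (d + N) := Real.sq_sqrt (by positivity)
  have hl0 : 0 < l := Real.sqrt_pos.2 (by positivity)
  have hr0 : 0 < r := Real.sqrt_pos.2 (by positivity)
  refine (volume_slab_le F ht hl0 hr0 (by rw [hl2, hr2]; field_simp; linarith)).trans ?_
  gcongr
  have hq : (1 / 2 : ℝ) ^ ((n : ℝ) / 8) = Real.sqrt ((1 / 2 : ℝ) ^ ((n : ℝ) / 4)) := by
    rw [Real.sqrt_eq_rpow, ← Real.rpow_mul (by norm_num)]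
    ring_nf
  rw [hq]
  refine Real.le_sqrt_of_sq_le ?_
  have ht2 : 9 * Real.exp 1 ^ 2 * k * d * t ^ 2 ≤ n := by
    have h1 : (3 * Real.exp 1 * Real.sqrt ((k : ℝ) * d / n) * t) ^ 2 ≤ 1 :=
      pow_le_one₀ (by positivity) htk
    rw [mul_pow, mul_pow, mul_pow, Real.sq_sqrt (by positivity)] at h1
    field_simp at h1
    linarith
  have he : (2 : ℝ) ≤ Real.exp 1 := by linarith [Real.add_one_le_exp (1 : ℝ)]
  -- From `N ≤ d`, `9 e ≥ 18` and `k ≥ 1`: `2 t² (d + N) e ≤ 4 d t² e ≤ 2 n / 9 ≤ n / 4 ≤ N`.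
  have hb : t ^ 2 * ((d + N) / N) * Real.exp 1 ≤ 1 / 2 := by
    have h1 : 2 * (t ^ 2 * (d + N) * Real.exp 1) ≤ N := by
      have h2 : t ^ 2 * (d + N) * Real.exp 1 ≤ t ^ 2 * (d + d) * Real.exp 1 := by gcongr
      have h3 : 18 * (k * (d * t ^ 2 * Real.exp 1)) ≤ n := by
        refine le_trans ?_ ht2
        have : 0 ≤ k * (d * t ^ 2 * Real.exp 1) := by positivity
        nlinarith
      have h4 : d * t ^ 2 * Real.exp 1 ≤ k * (d * t ^ 2 * Real.exp 1) :=
        le_mul_of_one_le_left (by positivity) hk1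
      nlinarith
    rw [← mul_div_assoc, div_mul_eq_mul_div, div_le_iff₀ hN0]
    linarith
  calc ((t / l) ^ N * (1 / r) ^ (d - N)) ^ 2
      = (t ^ 2 * ((d + N) / N)) ^ N * (1 + N / d) ^ (d - N) := by
        have h1 : (t / l) ^ 2 = t ^ 2 * ((d + N) / N) := by
          rw [div_pow, hl2, div_div_eq_mul_div, mul_div_assoc]
        have h2 : (1 / r) ^ 2 = 1 + (N : ℝ) / d := by
          rw [div_pow, hr2]
          field_simp
        rw [mul_pow, ← pow_mul, ← pow_mul, mul_comm N, mul_comm (d - N), pow_mul, pow_mul, h1, h2]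
    _ ≤ (t ^ 2 * ((d + N) / N)) ^ N * Real.exp 1 ^ N := by
        gcongr
        calc (1 + (N : ℝ) / d) ^ (d - N) ≤ (1 + (N : ℝ) / d) ^ d := by
              gcongr
              · have : 0 ≤ (N : ℝ) / d := by positivity
                linarith
              · lia
          _ ≤ Real.exp (N / d) ^ d := by
              gcongr
              linarith [Real.add_one_le_exp ((N : ℝ) / d)]
          _ = Real.exp 1 ^ N := by
              rw [← Real.exp_nat_mul, ← Real.exp_nat_mul]
              congr 1
              field_simp
    _ ≤ (1 / 2) ^ N := by
        rw [← mul_pow]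
        gcongr
    _ = (1 / 2 : ℝ) ^ (N : ℝ) := by rw [Real.rpow_natCast]
    _ ≤ (1 / 2 : ℝ) ^ ((n : ℝ) / 4) :=
        Real.rpow_le_rpow_of_exponent_ge (by norm_num) (by norm_num) hF

/-! ### Anti-concentration of a rotated family of vectors -/

/-- The reflection in the hyperplane orthogonal to `a - b` works: it swaps vectors of equal norm,
and the hyperplane contains `K` because `a - b ∈ Kᗮ`. -/
lemma exists_iso_fix_apply_eq {d : ℕ} (K : Submodule ℝ (Vec d)) {a b : Vec d} (ha : a ∈ Kᗮ)
    (hb : b ∈ Kᗮ) (hab : ‖a‖ = ‖b‖) :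
    ∃ S : OrthGroup d, (∀ z ∈ K, iso S z = z) ∧ iso S a = b := by
  obtain ⟨S, hS⟩ := exists_iso_eq (Submodule.reflection (ℝ ∙ (a - b))ᗮ)
  refine ⟨S, fun z hz => ?_, ?_⟩
  · rw [hS]
    refine Submodule.reflection_mem_subspace_eq_self ?_
    rw [Submodule.mem_orthogonal_singleton_iff_inner_left]
    exact Submodule.inner_right_of_mem_orthogonal hz (Kᗮ.sub_mem ha hb)
  · rw [hS]
    exact Submodule.reflection_sub hab

lemma finrank_le_finrank_map_inf_orthogonal {d : ℕ} (F K : Submodule ℝ (Vec d))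
    (T : OrthGroup d) :
    Module.finrank ℝ F ≤
      Module.finrank ℝ (F.map (iso T).toLinearEquiv.toLinearMap ⊓ Kᗮ : Submodule ℝ (Vec d))
        + Module.finrank ℝ K := by
  have h1 := Submodule.finrank_sup_add_finrank_inf_eq
    (F.map (iso T).toLinearEquiv.toLinearMap) Kᗮ
  have h2 := K.finrank_add_finrank_orthogonal
  have h3 := Submodule.finrank_le (F.map (iso T).toLinearEquiv.toLinearMap ⊔ Kᗮ)
  rw [LinearEquiv.finrank_map_eq] at h1
  omega

/-- A vector of which a part of norm at least `γ` is orthogonal to `K` is unlikely to be mapped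
close to `Fᗮ` by a random rotation, even conditionally on the images of the elements of `K`. -/
lemma haarOrth_inter_le {d n k : ℕ} (F K : Submodule ℝ (Vec d)) (y : Vec d) {β γ : ℝ}
    (hβ : 0 < β) (hγ : 0 < γ) (hy : γ ≤ ‖Kᗮ.starProjection y‖)
    (hk : 1 ≤ k) (hn : 1 ≤ n) (hnd : n ≤ d)
    (hF : (n : ℝ) / 4 + Module.finrank ℝ K ≤ Module.finrank ℝ F)
    (hγβ : 3 * Real.exp 1 * Real.sqrt ((k : ℝ) * d / n) ≤ γ / β)
    {A : Set (OrthGroup d)} (hAm : MeasurableSet A)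
    (hA : ∀ S T : OrthGroup d, (∀ z ∈ K, iso S z = z) → T ∈ A → S * T ∈ A) :
    haarOrth d (A ∩ {T | ‖F.starProjection (iso T⁻¹ y)‖ ≤ β}) ≤
      ENNReal.ofReal ((1 / 2 : ℝ) ^ ((n : ℝ) / 8)) * haarOrth d A := by
  set c := K.starProjection y
  set p := Kᗮ.starProjection y
  have hp0 : 0 < ‖p‖ := hγ.trans_le hy
  have hyp : c + p = y := K.starProjection_add_starProjection_orthogonal y
  set P := Kᗮ.starProjection
  set B := A ∩ {T | ‖F.starProjection (iso T⁻¹ y)‖ ≤ β}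
  -- The component `p` of `y` is replaced by a vector of the same norm in the direction of `P x`,
  -- with `x` random in the unit ball. Everything is multiplied by `‖P x‖` so that no division
  -- occurs; the inequality is trivial when `P x = 0`.
  set G : Set (OrthGroup d × Vec d) := {q | q.1 ∈ A ∧
    ‖F.starProjection (iso q.1⁻¹ (‖P q.2‖ • c + ‖p‖ • P q.2))‖ ≤ β * ‖P q.2‖} with hG
  have hGm : MeasurableSet G := by
    have h0 : Continuous fun x : Vec d => ‖P x‖ • c + ‖p‖ • P x := by fun_prop
    have h1 : Continuous fun q : OrthGroup d × Vec d =>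
        (q.1⁻¹, ‖P q.2‖ • c + ‖p‖ • P q.2) :=
      (continuous_inv.comp continuous_fst).prodMk (h0.comp continuous_snd)
    have h2 : Continuous fun q : OrthGroup d × Vec d => β * ‖P q.2‖ :=
      (by fun_prop : Continuous fun x : Vec d => β * ‖P x‖).comp continuous_snd
    have h3 : IsClosed {q : OrthGroup d × Vec d |
        ‖F.starProjection (iso q.1⁻¹ (‖P q.2‖ • c + ‖p‖ • P q.2))‖ ≤ β * ‖P q.2‖} :=
      isClosed_le (F.starProjection.continuous.comp (continuous_iso_apply.comp h1)).norm h2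
    exact (measurable_fst hAm).inter h3.measurableSet
  set ball := Metric.closedBall (0 : Vec d) 1 with hball
  set ν := (volume : Measure (Vec d)).restrict ball
  -- For fixed `x`, left translation by a rotation that fixes `K` and turns `p` to the direction of
  -- `P x` maps `B` into the slice and preserves Haar measure.
  have hslice : ∀ x : Vec d, haarOrth d B ≤ haarOrth d ((fun T => (T, x)) ⁻¹' G) := by
    intro x
    by_cases hx : P x = 0
    · refine measure_mono fun T hT => ⟨hT.1, ?_⟩
      simp [hx]
    have hx0 : 0 < ‖P x‖ := norm_pos_iff.2 hx
    obtain ⟨S, hSK, hSp⟩ := exists_iso_fix_apply_eq K (a := p) (b := (‖p‖ / ‖P x‖) • P x)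
      (Kᗮ.starProjection_apply_mem y) (Kᗮ.smul_mem _ (Kᗮ.starProjection_apply_mem x)) (by
        rw [norm_smul, norm_div, norm_norm, norm_norm]
        field_simp)
    have hSy : ‖P x‖ • iso S y = ‖P x‖ • c + ‖p‖ • P x := by
      rw [← hyp, map_add, hSp, hSK c (K.starProjection_apply_mem y), smul_add, smul_smul]
      congr 2
      field_simp
    rw [← measure_preimage_mul (haarOrth d) S ((fun T => (T, x)) ⁻¹' G)]
    refine measure_mono fun T hT => ⟨hA S T hSK hT.1, ?_⟩
    change ‖F.starProjection (iso (S * T)⁻¹ (‖P x‖ • c + ‖p‖ • P x))‖ ≤ β * ‖P x‖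
    rw [← hSy, mul_inv_rev, iso_mul_apply, map_smul, iso_inv S, LinearIsometryEquiv.symm_apply_apply,
      map_smul, map_smul, norm_smul, norm_norm, mul_comm]
    gcongr
    exact hT.2
  have hsec : ∀ T : OrthGroup d, ν (Prod.mk T ⁻¹' G) ≤
      A.indicator (fun _ => ENNReal.ofReal ((1 / 2 : ℝ) ^ ((n : ℝ) / 8)) * volume ball) T := by
    intro T
    by_cases hT : T ∈ A
    swap
    · have : Prod.mk T ⁻¹' G = ∅ := Set.eq_empty_of_forall_notMem fun x hx => hT hx.1
      simp [this]
    rw [Set.indicator_of_mem hT, Measure.restrict_apply (measurable_prodMk_left hGm)]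
    -- Projecting to `F'` kills `c ∈ K` and does not distinguish `P x` from `x`, so the section lies
    -- in a slab of half-width `β / γ`.
    set F' := F.map (iso T).toLinearEquiv.toLinearMap ⊓ Kᗮ
    have hdim := finrank_le_finrank_map_inf_orthogonal F K T
    have hdim' : (Module.finrank ℝ F : ℝ) ≤ Module.finrank ℝ F' + Module.finrank ℝ K := by
      exact_mod_cast hdim
    refine le_trans (measure_mono ?_) (volume_slab_le_rpow F' (t := β / γ) (by positivity)
      hk hn hnd (by linarith) ?_)
    swap
    · calc _ ≤ γ / β * (β / γ) := by gcongr
        _ = 1 := by field_simp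
    rintro x ⟨⟨-, hx⟩, hx1⟩
    have hx1 : ‖x‖ ≤ 1 := by simpa [hball] using hx1
    refine ⟨hx1, ?_⟩
    have h1 : F'.starProjection c = 0 := by
      rw [Submodule.starProjection_apply_eq_zero_iff]
      intro z hz
      exact Submodule.inner_left_of_mem_orthogonal (K.starProjection_apply_mem y) hz.2
    have h2 : F'.starProjection (P x) = F'.starProjection x := by
      rw [← ContinuousLinearMap.comp_apply,
        Submodule.starProjection_comp_starProjection_of_le inf_le_right]
    have h3 : ‖p‖ * ‖F'.starProjection x‖ ≤ β := by
      calc ‖p‖ * ‖F'.starProjection x‖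
          = ‖F'.starProjection (‖P x‖ • c + ‖p‖ • P x)‖ := by
            rw [map_add, map_smul, map_smul, h1, h2, smul_zero, zero_add, norm_smul, norm_norm]
        _ ≤ ‖(F.map (iso T).toLinearEquiv.toLinearMap).starProjection
              (‖P x‖ • c + ‖p‖ • P x)‖ := norm_starProjection_mono inf_le_left _
        _ ≤ β * ‖P x‖ := by
            rw [norm_starProjection_map_iso]
            exact hx
        _ ≤ β := mul_le_of_le_one_right hβ.le ((Kᗮ.norm_starProjection_apply_le x).trans hx1)
    rw [le_div_iff₀ hγ]
    nlinarith [norm_nonneg (F'.starProjection x)]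
  have hpos : volume ball ≠ 0 := (Metric.measure_closedBall_pos _ _ one_pos).ne'
  have hfin : volume ball ≠ ⊤ := measure_closedBall_lt_top.ne
  have hfub : haarOrth d B * volume ball ≤
      ENNReal.ofReal ((1 / 2 : ℝ) ^ ((n : ℝ) / 8)) * haarOrth d A * volume ball := by
    calc haarOrth d B * volume ball = ∫⁻ _, haarOrth d B ∂ν := by simp [ν]
      _ ≤ ∫⁻ x, haarOrth d ((fun T => (T, x)) ⁻¹' G) ∂ν := lintegral_mono hslice
      _ = ∫⁻ T, ν (Prod.mk T ⁻¹' G) ∂(haarOrth d) := by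
          rw [← Measure.prod_apply_symm hGm, Measure.prod_apply hGm]
      _ ≤ ∫⁻ T, A.indicator (fun _ =>
            ENNReal.ofReal ((1 / 2 : ℝ) ^ ((n : ℝ) / 8)) * volume ball) T ∂(haarOrth d) :=
          lintegral_mono hsec
      _ = _ := by
          rw [lintegral_indicator_const hAm]
          ring
  exact (ENNReal.mul_le_mul_iff_left hpos hfin).1 hfub

lemma haarOrth_forall_le {d n k : ℕ} (F : Submodule ℝ (Vec d)) (y : Fin k → Vec d) {β γ : ℝ}
    (hβ : 0 < β) (hγ : 0 < γ) (hn : 1 ≤ n) (hnd : n ≤ d)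
    (hy : ∀ i, γ ≤ ‖(Submodule.span ℝ (y '' {j | j < i}))ᗮ.starProjection (y i)‖)
    (hF : (n : ℝ) / 4 + k ≤ Module.finrank ℝ F)
    (hγβ : 3 * Real.exp 1 * Real.sqrt ((k : ℝ) * d / n) ≤ γ / β) (l : ℕ) (hl : l ≤ k) :
    haarOrth d {T | ∀ i : Fin k, (i : ℕ) < l → ‖F.starProjection (iso T⁻¹ (y i))‖ ≤ β} ≤
      ENNReal.ofReal ((1 / 2 : ℝ) ^ ((n : ℝ) / 8)) ^ l := by
  induction l with
  | zero => simp
  | succ l ih =>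
    set A := {T : OrthGroup d | ∀ i : Fin k, (i : ℕ) < l →
      ‖F.starProjection (iso T⁻¹ (y i))‖ ≤ β} with hA
    set i₀ : Fin k := ⟨l, hl⟩
    set K := Submodule.span ℝ (y '' {j | j < i₀}) with hK
    have hdim : Module.finrank ℝ K ≤ k := by
      have h1 := finrank_span_finset_le_card (R := ℝ) ((Finset.univ.filter (· < i₀)).image y)
      have h2 : Finset.card ((Finset.univ.filter (· < i₀)).image y) ≤ k :=
        Finset.card_image_le.trans ((Finset.card_filter_le _ _).trans (by simp))
      refine le_trans (le_of_eq ?_) (h1.trans h2)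
      have h3 : {j | j < i₀} = (Finset.univ.filter (· < i₀) : Set (Fin k)) := by
        ext j
        simp
      rw [hK, Set.finrank, Finset.coe_image, h3]
    have hdim' : (Module.finrank ℝ K : ℝ) ≤ k := by exact_mod_cast hdim
    have hAm : MeasurableSet A := by
      simp only [hA, Set.ofPred_forall]
      refine MeasurableSet.iInter fun i => MeasurableSet.iInter fun _ => ?_
      refine (isClosed_le ?_ continuous_const).measurableSet
      exact (F.starProjection.continuous.comp
        (continuous_iso_apply.comp (continuous_inv.prodMk continuous_const))).norm
    -- The event `A` depends on `T` only through `T⁻¹ (y j)` with `y j ∈ K`, hence is stable under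
    -- left multiplication by rotations fixing `K`.
    have step := haarOrth_inter_le F K (y i₀) hβ hγ (hy i₀) (by lia : 1 ≤ k) hn hnd
      (by linarith) hγβ hAm (by
        intro S T hS hT i hi
        have h1 : iso S⁻¹ (y i) = y i := by
          rw [iso_inv, LinearIsometryEquiv.symm_apply_eq]
          exact (hS _ (Submodule.subset_span ⟨i, hi, rfl⟩)).symm
        rw [mul_inv_rev, iso_mul_apply, h1]
        exact hT i hi)
    refine le_trans (measure_mono fun T hT => ?_) (step.trans ?_)
    · exact ⟨fun i hi => hT i (by lia), hT i₀ (by simp [i₀])⟩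
    · rw [pow_succ']
      gcongr
      exact ih (by lia)

/-- A uniform subspace rarely wins against a fixed family of vectors. -/
lemma haarOrth_wins_le {d n k : ℕ} (F : Submodule ℝ (Vec d)) (y : Fin k → Vec d) {β γ : ℝ}
    (hβ : 0 < β) (hγ : 0 < γ) (hn : 1 ≤ n) (hnd : n ≤ d)
    (hF : (n : ℝ) / 4 + k ≤ Module.finrank ℝ F)
    (hγβ : 3 * Real.exp 1 * Real.sqrt ((k : ℝ) * d / n) ≤ γ / β) :
    haarOrth d {T | Wins β γ (F.map (iso T).toLinearEquiv.toLinearMap) y} ≤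
      ENNReal.ofReal ((1 / 2 : ℝ) ^ ((n : ℝ) / 8)) ^ k := by
  by_cases hy : ∀ i, γ ≤ ‖(Submodule.span ℝ (y '' {j | j < i}))ᗮ.starProjection (y i)‖
  · refine le_trans (measure_mono ?_) (haarOrth_forall_le F y hβ hγ hn hnd hy hF hγβ k le_rfl)
    intro T hT
    simp only [Set.mem_ofPred_eq] at hT ⊢
    intro i _
    rw [← norm_starProjection_map_iso]
    exact (hT i).1
  · have : {T | Wins β γ (F.map (iso T).toLinearEquiv.toLinearMap) y} = ∅ :=
      Set.eq_empty_of_forall_notMem fun T hT => hy fun i => (hT i).2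
    simp [this]

/-! ### Rotations fixing a subspace -/

lemma exists_linearIsometry_of_finrank_le {d : ℕ} (F G : Submodule ℝ (Vec d))
    (h : Module.finrank ℝ F ≤ Module.finrank ℝ G) :
    ∃ f : F →ₗᵢ[ℝ] Vec d, ∀ x, f x ∈ G := by
  set b := stdOrthonormalBasis ℝ F
  set c := stdOrthonormalBasis ℝ G
  set f : F →ₗ[ℝ] G := b.toBasis.constr ℝ fun i => c (Fin.castLE h i) with hf
  have hb : Orthonormal ℝ b.toBasis := by
    rw [b.coe_toBasis]; exact b.orthonormal
  have hfb : Orthonormal ℝ (f ∘ b.toBasis) := by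
    have : f ∘ b.toBasis = c ∘ Fin.castLE h := by
      ext i
      simp [hf]
    rw [this]
    exact c.orthonormal.comp _ (Fin.castLE_injective h)
  exact ⟨G.subtypeₗᵢ.comp (f.isometryOfOrthonormal hb hfb), fun x => (f x).2⟩

/-- If `V ≤ E` and `dim V + dim F ≤ dim E`, then some rotation which fixes `V` pointwise maps `E` to
a subspace that contains `F`. -/
lemma exists_iso_fix_le_map {d : ℕ} {V E : Submodule ℝ (Vec d)} (F : Submodule ℝ (Vec d))
    (hVE : V ≤ E) (hdim : Module.finrank ℝ V + Module.finrank ℝ F ≤ Module.finrank ℝ E) :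
    ∃ S : OrthGroup d, (∀ v ∈ V, iso S v = v) ∧
      F ≤ E.map (iso S).toLinearEquiv.toLinearMap := by
  set F₁ := F.map Vᗮ.starProjection.toLinearMap with hF₁
  have hF₁V : F₁ ≤ Vᗮ := by
    rintro _ ⟨x, -, rfl⟩
    exact Vᗮ.starProjection_apply_mem x
  have hdim₁ : Module.finrank ℝ F₁ ≤ Module.finrank ℝ (Vᗮ ⊓ E : Submodule ℝ (Vec d)) := by
    have h1 : Module.finrank ℝ F₁ ≤ Module.finrank ℝ F := Submodule.finrank_map_le _ F
    have h2 := Submodule.finrank_add_inf_finrank_orthogonal hVE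
    omega
  obtain ⟨f, hf⟩ := exists_linearIsometry_of_finrank_le F₁ (Vᗮ ⊓ E) hdim₁
  -- `g` glues the identity on `V` to an isometric embedding of `F₁` into `Vᗮ ⊓ E`. It is isometric
  -- on `V ⊔ F₁`, which contains `F`, and sends `F` into `E`; the inverse of an isometric extension
  -- is the rotation sought.
  set g : Vec d →ₗ[ℝ] Vec d := V.starProjection.toLinearMap +
    f.toLinearMap ∘ₗ F₁.orthogonalProjectionOnto.toLinearMap with hg
  have hgV : ∀ v ∈ V, g v = v := by
    intro v hv
    have h1 : F₁.orthogonalProjectionOnto v = 0 :=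
      Submodule.orthogonalProjectionOnto_apply_of_mem_orthogonal
        (Submodule.orthogonal_le hF₁V (V.le_orthogonal_orthogonal hv))
    simp [hg, h1, Submodule.starProjection_eq_self_iff.2 hv]
  have hgF : ∀ x : F₁, g x = f x := by
    intro x
    have h1 : V.starProjection (x : Vec d) = 0 :=
      V.starProjection_apply_eq_zero_iff.2 (hF₁V x.2)
    simp [hg, h1]
  have hnorm : ∀ x ∈ V ⊔ F₁, ‖g x‖ = ‖x‖ := by
    intro x hx
    obtain ⟨v, hv, w, hw, rfl⟩ := Submodule.mem_sup.1 hx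
    have h1 : g w = f ⟨w, hw⟩ := hgF ⟨w, hw⟩
    have h2 := norm_add_sq_eq_norm_sq_add_norm_sq_of_inner_eq_zero v w
      (Submodule.inner_right_of_mem_orthogonal hv (hF₁V hw))
    have h3 := norm_add_sq_eq_norm_sq_add_norm_sq_of_inner_eq_zero v (f ⟨w, hw⟩)
      (Submodule.inner_right_of_mem_orthogonal hv (hf _).1)
    rw [f.norm_map, Submodule.coe_norm] at h3
    rw [map_add, hgV v hv, h1]
    exact (mul_self_inj (norm_nonneg _) (norm_nonneg _)).1 (h3.trans h2.symm)
  set L : (V ⊔ F₁ : Submodule ℝ (Vec d)) →ₗᵢ[ℝ] Vec d :=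
    ⟨g.domRestrict (V ⊔ F₁), fun x => hnorm x x.2⟩ with hL
  obtain ⟨R, hR⟩ := exists_iso_eq (L.extend.toLinearIsometryEquiv rfl)
  have hRg : ∀ x ∈ V ⊔ F₁, iso R x = g x := by
    intro x hx
    rw [hR]
    exact L.extend_apply ⟨x, hx⟩
  refine ⟨R⁻¹, fun v hv => ?_, fun x hx => ?_⟩
  · rw [iso_inv, LinearIsometryEquiv.symm_apply_eq, hRg v (Submodule.mem_sup_left hv), hgV v hv]
  · have hx₁ : Vᗮ.starProjection x ∈ F₁ := ⟨x, hx, rfl⟩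
    have hsum := V.starProjection_add_starProjection_orthogonal x
    have hV := V.starProjection_apply_mem x
    have hmem : x ∈ V ⊔ F₁ := by
      rw [← hsum]
      exact Submodule.add_mem_sup hV hx₁
    refine ⟨iso R x, ?_, ?_⟩
    · rw [SetLike.mem_coe, hRg x hmem, ← hsum, map_add, hgV _ hV, hgF ⟨_, hx₁⟩]
      exact E.add_mem (hVE hV) (hf _).2
    · rw [iso_inv]
      exact (iso R).symm_apply_apply x

/-! ### Measurability of the winning condition -/

/-- The projection onto a span is not continuous in the spanning vectors. Writing the distance to
the span as an infimum over coefficients turns the condition into an intersection of closed ones. -/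
lemma le_norm_starProjection_span_orthogonal_iff {d k : ℕ} (γ : ℝ) (y : Fin k → Vec d)
    (i : Fin k) :
    γ ≤ ‖(Submodule.span ℝ (y '' {j | j < i}))ᗮ.starProjection (y i)‖ ↔
      ∀ a : {j // j < i} → ℝ, γ ≤ ‖y i - ∑ j, a j • y j‖ := by
  set K := Submodule.span ℝ (y '' {j | j < i}) with hK
  have hKe : K = Submodule.span ℝ (Set.range fun j : {j // j < i} => y j) := by
    rw [hK, Set.image_eq_range]
    rfl
  have hP : Kᗮ.starProjection (y i) = y i - K.starProjection (y i) := by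
    rw [Submodule.starProjection_orthogonal']
    rfl
  rw [hP]
  constructor
  · intro h a
    refine h.trans ?_
    rw [Submodule.starProjection_minimal]
    have hmem : ∑ j, a j • y j ∈ K :=
      K.sum_mem fun j _ => K.smul_mem _ (Submodule.subset_span ⟨j, j.2, rfl⟩)
    exact ciInf_le ⟨0, by rintro _ ⟨x, rfl⟩; exact norm_nonneg _⟩ (⟨_, hmem⟩ : K)
  · intro h
    have hmem := K.starProjection_apply_mem (y i)
    rw [hKe, Submodule.mem_span_range_iff_exists_fun] at hmem
    obtain ⟨a, ha⟩ := hmem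
    rw [hKe, ← ha]
    exact h a

lemma isClosed_wins {d k : ℕ} (β γ : ℝ) (F : Submodule ℝ (Vec d)) :
    IsClosed {p : OrthGroup d × (Fin k → Vec d) |
      Wins β γ (F.map (iso p.1).toLinearEquiv.toLinearMap) p.2} := by
  simp only [Wins, norm_starProjection_map_iso, le_norm_starProjection_span_orthogonal_iff,
    Set.ofPred_forall, Set.ofPred_and]
  refine isClosed_iInter fun i => IsClosed.inter (isClosed_le ?_ continuous_const)
    (isClosed_iInter fun a => isClosed_le continuous_const (by fun_prop))
  have h1 : Continuous fun p : OrthGroup d × (Fin k → Vec d) => (p.1⁻¹, p.2 i) :=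
    (continuous_inv.comp continuous_fst).prodMk (by fun_prop)
  exact (F.starProjection.continuous.comp (continuous_iso_apply.comp h1)).norm

lemma Wins.mono {d k : ℕ} {β γ : ℝ} {F E : Submodule ℝ (Vec d)} {y : Fin k → Vec d}
    (h : Wins β γ E y) (hFE : F ≤ E) : Wins β γ F y := fun i =>
  ⟨(norm_starProjection_mono hFE (y i)).trans (h i).1, (h i).2⟩

lemma map_iso_mul {d : ℕ} (U V : OrthGroup d) (F : Submodule ℝ (Vec d)) :
    F.map (iso (U * V)).toLinearEquiv.toLinearMap
      = (F.map (iso V).toLinearEquiv.toLinearMap).map (iso U).toLinearEquiv.toLinearMap := by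
  rw [← Submodule.map_comp]
  congr 1

/-- The player who observes the rotated vectors `U w j`, where `w j ∈ E`, rarely wins against the
rotated subspace `U E`. -/
lemma haarOrth_wins_comp_le {d n k m : ℕ} (E : Submodule ℝ (Vec d)) (w : Fin m → Vec d)
    (hw : ∀ r, w r ∈ E) {g : (Fin m → Vec d) → Fin k → Vec d} (hg : Measurable g) {β γ : ℝ}
    (hβ : 0 < β) (hγ : 0 < γ) (hn : 1 ≤ n) (hnd : n ≤ d) (hE : Module.finrank ℝ E = n)
    (hm : (m : ℝ) ≤ (n : ℝ) / 2) (hkn : (k : ℝ) ≤ (n : ℝ) / 4)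
    (hγβ : 3 * Real.exp 1 * Real.sqrt ((k : ℝ) * d / n) ≤ γ / β) :
    haarOrth d {U | Wins β γ (E.map (iso U).toLinearEquiv.toLinearMap)
        (g fun r => iso U (w r))} ≤
      ENNReal.ofReal ((1 / 2 : ℝ) ^ ((n : ℝ) / 8)) ^ k := by
  have hmn : m ≤ n := by
    have : (m : ℝ) ≤ n := hm.trans (by linarith [(Nat.cast_nonneg n : (0 : ℝ) ≤ n)])
    exact_mod_cast this
  -- Only the dimension of `F` matters: `n - m ≥ n / 2 ≥ n / 4 + k`.
  set F : Submodule ℝ (Vec d) := (coordSubspace d (n - m) (by lia)).1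
  have hF : Module.finrank ℝ F = n - m := (coordSubspace d (n - m) (by lia)).2
  set V := Submodule.span ℝ (Set.range w)
  have hV : Module.finrank ℝ V ≤ m := by
    simpa [Set.finrank] using finrank_range_le_card (R := ℝ) w
  have hVE : V ≤ E := Submodule.span_le.2 (by rintro _ ⟨r, rfl⟩; exact hw r)
  set y : OrthGroup d → Fin k → Vec d := fun U => g fun r => iso U (w r)
  have hy : Measurable y := by
    refine hg.comp (measurable_pi_lambda _ fun r => Continuous.measurable ?_)
    exact continuous_iso_apply.comp (by fun_prop : Continuous fun U : OrthGroup d => (U, w r))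
  -- Here `U T F` with `T` an independent Haar rotation is the part of the subspace that the samples
  -- do not determine.
  set G : Set (OrthGroup d × OrthGroup d) :=
    {q | Wins β γ (F.map (iso (q.1 * q.2)).toLinearEquiv.toLinearMap) (y q.1)}
  have hGm : MeasurableSet G := by
    have h1 : Measurable fun q : OrthGroup d × OrthGroup d => (q.1 * q.2, y q.1) :=
      continuous_mul.measurable.prodMk (hy.comp measurable_fst)
    exact h1 (isClosed_wins β γ F).measurableSet
  have hslice : ∀ T : OrthGroup d,
      haarOrth d {U | Wins β γ (E.map (iso U).toLinearEquiv.toLinearMap) (y U)} ≤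
        haarOrth d ((fun U => (U, T)) ⁻¹' G) := by
    intro T
    obtain ⟨S, hS, hSE⟩ := exists_iso_fix_le_map (F.map (iso T).toLinearEquiv.toLinearMap) hVE
      (by
        rw [LinearEquiv.finrank_map_eq, hF, hE]
        exact (Nat.add_le_add_right hV _).trans (by lia))
    -- Replacing `U` by `U S` leaves the observed vectors unchanged, since `S` fixes every `w r`,
    -- while `U S E` contains `U T F`.
    rw [← measure_preimage_mul_right (haarOrth d) S
      {U | Wins β γ (E.map (iso U).toLinearEquiv.toLinearMap) (y U)}]
    refine measure_mono fun U hU => ?_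
    have hyU : y (U * S) = y U := by
      simp only [y, iso_mul_apply]
      congr 1
      ext1 r
      rw [hS _ (Submodule.subset_span ⟨r, rfl⟩)]
    simp only [Set.mem_preimage, Set.mem_ofPred_eq, hyU, map_iso_mul] at hU
    simp only [Set.mem_preimage, G, Set.mem_ofPred_eq, map_iso_mul]
    exact hU.mono (Submodule.map_mono hSE)
  have hsec : ∀ U : OrthGroup d, haarOrth d (Prod.mk U ⁻¹' G) ≤
      ENNReal.ofReal ((1 / 2 : ℝ) ^ ((n : ℝ) / 8)) ^ k := by
    intro U
    have h1 : Prod.mk U ⁻¹' G =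
        (U * ·) ⁻¹' {T | Wins β γ (F.map (iso T).toLinearEquiv.toLinearMap) (y U)} := rfl
    rw [h1, measure_preimage_mul]
    refine haarOrth_wins_le F (y U) hβ hγ hn hnd ?_ hγβ
    rw [hF, Nat.cast_sub hmn]
    linarith
  calc haarOrth d {U | Wins β γ (E.map (iso U).toLinearEquiv.toLinearMap) (y U)}
      = ∫⁻ _, haarOrth d {U | Wins β γ (E.map (iso U).toLinearEquiv.toLinearMap) (y U)}
          ∂(haarOrth d) := by simp
    _ ≤ ∫⁻ T, haarOrth d ((fun U => (U, T)) ⁻¹' G) ∂(haarOrth d) := lintegral_mono hslice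
    _ = ∫⁻ U, haarOrth d (Prod.mk U ⁻¹' G) ∂(haarOrth d) := by
        rw [← Measure.prod_apply_symm hGm, Measure.prod_apply hGm]
    _ ≤ ∫⁻ _, ENNReal.ofReal ((1 / 2 : ℝ) ^ ((n : ℝ) / 8)) ^ k ∂(haarOrth d) :=
        lintegral_mono hsec
    _ = _ := by simp

/-! ### Rotations of the uniform distribution on a sphere -/

/-- Surface measure is expressed through the volume of a cone in the unit ball, each ingredient of
which is transported by a linear isometry. -/
lemma uniformSphere_apply {d : ℕ} (E : Submodule ℝ (Vec d)) {A : Set (Vec d)}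
    (hA : MeasurableSet A) :
    uniformSphere E A = (Module.finrank ℝ E * volume (Metric.ball (0 : E) 1))⁻¹ *
      (Module.finrank ℝ E *
        volume {x : E | 0 < ‖x‖ ∧ ‖x‖ < 1 ∧ ‖x‖⁻¹ • (x : Vec d) ∈ A}) := by
  have hm : Measurable fun x : Metric.sphere (0 : E) 1 => ((x : E) : Vec d) :=
    measurable_subtype_coe.comp measurable_subtype_coe
  rw [uniformSphere, Measure.map_apply hm hA, Measure.smul_apply, smul_eq_mul,
    Measure.toSphere_apply_univ, Measure.toSphere_apply' _ (hm hA)]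
  congr 3
  ext x
  simp only [Set.mem_smul, Set.mem_image, Set.mem_preimage, Set.mem_Ioo, Set.mem_ofPred_eq]
  constructor
  · rintro ⟨a, ⟨ha0, ha1⟩, _, ⟨z, hz, rfl⟩, rfl⟩
    have hz1 : ‖(z : E)‖ = 1 := by simp
    rw [norm_smul, hz1, mul_one, Real.norm_of_nonneg ha0.le]
    refine ⟨ha0, ha1, ?_⟩
    rwa [Submodule.coe_smul, smul_smul, inv_mul_cancel₀ ha0.ne', one_smul]
  · rintro ⟨h0, h1, hx⟩
    refine ⟨‖x‖, ⟨h0, h1⟩, ‖x‖⁻¹ • x, ⟨⟨‖x‖⁻¹ • x, ?_⟩, hx, rfl⟩, ?_⟩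
    · rw [mem_sphere_zero_iff_norm, norm_smul, norm_inv, norm_norm, inv_mul_cancel₀ h0.ne']
    · rw [smul_smul, mul_inv_cancel₀ h0.ne', one_smul]

lemma uniformSphere_map_iso {d : ℕ} (U : OrthGroup d) (E : Submodule ℝ (Vec d)) :
    uniformSphere (E.map (iso U).toLinearEquiv.toLinearMap)
      = (uniformSphere E).map (iso U) := by
  ext A hA
  set E' := E.map (iso U).toLinearEquiv.toLinearMap
  have hUm : Measurable (iso U) := (iso U).continuous.measurable
  set e : E ≃ₗᵢ[ℝ] E' := (iso U).submoduleMap E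
  have he : ∀ x : E, ((e x : E') : Vec d) = iso U x := fun x => rfl
  rw [Measure.map_apply hUm hA, uniformSphere_apply E' hA, uniformSphere_apply E (hUm hA),
    ← e.toLinearEquiv.finrank_eq,
    ← e.measurePreserving.measure_preimage_equiv (f := e.toMeasurableEquiv),
    ← e.measurePreserving.measure_preimage_equiv (f := e.toMeasurableEquiv)]
  congr 5
  · ext x
    simp
  · ext x
    simp [he]

lemma ae_uniformSphere_mem {d : ℕ} (E : Submodule ℝ (Vec d)) :
    ∀ᵐ x ∂(uniformSphere E), x ∈ E := by
  refine (ae_map_iff ?_ ?_).2 (Filter.Eventually.of_forall fun x => (x : E).2)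
  · exact (measurable_subtype_coe.comp measurable_subtype_coe).aemeasurable
  · exact E.closed_of_finiteDimensional.measurableSet

/-! ### The winning probability of the game -/

/-- The pairs of a rotation `U` and a batch `w` of samples such that the player who observes `U w`
wins against `U E`. -/
def winSet {d k m : ℕ} (β γ : ℝ) (E : Submodule ℝ (Vec d)) (g : (Fin m → Vec d) → Fin k → Vec d) :
    Set (OrthGroup d × (Fin m → Vec d)) :=
  {q | Wins β γ (E.map (iso q.1).toLinearEquiv.toLinearMap) (g fun r => iso q.1 (q.2 r))}

lemma measurableSet_winSet {d k m : ℕ} (β γ : ℝ) (E : Submodule ℝ (Vec d))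
    {g : (Fin m → Vec d) → Fin k → Vec d} (hg : Measurable g) :
    MeasurableSet (winSet β γ E g) := by
  have hact : Measurable fun q : OrthGroup d × (Fin m → Vec d) => fun r => iso q.1 (q.2 r) :=
    measurable_pi_lambda _ fun r => (continuous_iso_apply.comp
      (continuous_fst.prodMk ((continuous_apply r).comp continuous_snd))).measurable
  exact (measurable_fst.prodMk (hg.comp hact)) (isClosed_wins β γ E).measurableSet

lemma measurableSet_setOf_wins {d n k m : ℕ} (β γ : ℝ) (U : OrthGroup d) (E : Gr d n)
    {g : (Fin m → Vec d) → Fin k → Vec d} (hg : Measurable g) :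
    MeasurableSet {w | Wins β γ (rotate U E).1 (g w)} :=
  (measurable_const.prodMk hg : Measurable fun w => (U, g w))
    (isClosed_wins β γ E.1).measurableSet

/-- Sampling from `U E` amounts to rotating samples from `E` by `U`, which makes the law of the
samples independent of `U`. -/
lemma pi_uniformSphere_rotate_wins {d n k m : ℕ} (hn : 1 ≤ n) (β γ : ℝ) (U : OrthGroup d)
    (E : Gr d n) {g : (Fin m → Vec d) → Fin k → Vec d} (hg : Measurable g) :
    Measure.pi (fun _ : Fin m => uniformSphere (rotate U E).1)
        {w | Wins β γ (rotate U E).1 (g w)} =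
      Measure.pi (fun _ : Fin m => uniformSphere E.1) (Prod.mk U ⁻¹' winSet β γ E.1 g) := by
  have := isProbabilityMeasure_uniformSphere hn E
  have hUm : Measurable (iso U) := (iso U).continuous.measurable
  have hpi : Measure.pi (fun _ : Fin m => uniformSphere (rotate U E).1)
      = (Measure.pi fun _ : Fin m => uniformSphere E.1).map fun w r => iso U (w r) := by
    have : (fun _ : Fin m => uniformSphere (rotate U E).1)
        = fun _ : Fin m => (uniformSphere E.1).map (iso U) :=
      funext fun _ => uniformSphere_map_iso U E.1
    rw [this, Measure.pi_map_pi fun _ => hUm.aemeasurable]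
  rw [hpi, Measure.map_apply (by fun_prop) (measurableSet_setOf_wins β γ U E hg)]
  rfl

/-- For a fixed message and a single batch of samples, the player rarely wins. -/
lemma lintegral_pi_winSet_le {d n k m : ℕ} {g : (Fin m → Vec d) → Fin k → Vec d}
    (hg : Measurable g) {β γ : ℝ}
    (hβ : 0 < β) (hγ : 0 < γ) (hn : 1 ≤ n) (hnd : n ≤ d) (E : Gr d n)
    (hm : (m : ℝ) ≤ (n : ℝ) / 2) (hkn : (k : ℝ) ≤ (n : ℝ) / 4)
    (hγβ : 3 * Real.exp 1 * Real.sqrt ((k : ℝ) * d / n) ≤ γ / β) :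
    ∫⁻ U, Measure.pi (fun _ : Fin m => uniformSphere E.1) (Prod.mk U ⁻¹' winSet β γ E.1 g)
        ∂(haarOrth d) ≤
      ENNReal.ofReal ((1 / 2 : ℝ) ^ ((n : ℝ) / 8)) ^ k := by
  have := isProbabilityMeasure_uniformSphere hn E
  set μ := Measure.pi fun _ : Fin m => uniformSphere E.1
  have hGm := measurableSet_winSet β γ E.1 hg
  calc _ = ∫⁻ w, haarOrth d ((fun U => (U, w)) ⁻¹' winSet β γ E.1 g) ∂μ := by
        rw [← Measure.prod_apply hGm, Measure.prod_apply_symm hGm]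
    _ ≤ ∫⁻ _, ENNReal.ofReal ((1 / 2 : ℝ) ^ ((n : ℝ) / 8)) ^ k ∂μ := by
        refine lintegral_mono_ae ?_
        have hE : ∀ᵐ w ∂μ, ∀ r, w r ∈ E.1 := by
          rw [ae_all_iff]
          exact fun r => (measurePreserving_eval (fun _ : Fin m => uniformSphere E.1) r
            ).quasiMeasurePreserving.ae (ae_uniformSphere_mem E.1)
        filter_upwards [hE] with w hw
        exact haarOrth_wins_comp_le E.1 w hw hg hβ hγ hn hnd E.2 hm hkn hγβ
    _ = _ := by simp

/-- The vectors returned when the randomness is `ω` and the message is `s`, as a function of the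
batch of samples. -/
def Strategy.reply {Ω : Type*} [MeasurableSpace Ω] {d n M k m J : ℕ}
    (S : Strategy Ω d n M k m J) (ω : Ω) (s : Fin M → Bool) (w : Fin m → Vec d) (i : Fin k) :
    Vec d :=
  S.output (ω, s, w) i

lemma Strategy.measurable_reply {Ω : Type*} [MeasurableSpace Ω] {d n M k m J : ℕ}
    (S : Strategy Ω d n M k m J) (ω : Ω) (s : Fin M → Bool) : Measurable (S.reply ω s) :=
  measurable_pi_lambda _ fun i =>
    measurable_subtype_coe.comp ((measurable_pi_apply i).comp (S.measurable_output.comp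
      (measurable_const.prodMk (measurable_const.prodMk measurable_id))))

/-- The union bound over the batches and the messages. -/
lemma Strategy.pi_wins_le {Ω : Type*} [MeasurableSpace Ω] {d n M k m J : ℕ}
    (S : Strategy Ω d n M k m J) (ω : Ω) (hn : 1 ≤ n) (β γ : ℝ) (U : OrthGroup d)
    (E : Gr d n) :
    Measure.pi (fun _ : Fin J => Measure.pi fun _ : Fin m => uniformSphere (rotate U E).1)
        {v | Wins β γ (rotate U E).1 (S.play ω (rotate U E) v)} ≤
      ∑ _j : Fin J, ∑ s : Fin M → Bool, Measure.pi (fun _ : Fin m => uniformSphere E.1)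
        (Prod.mk U ⁻¹' winSet β γ E.1 (S.reply ω s)) := by
  have := isProbabilityMeasure_uniformSphere hn (rotate U E)
  have hsub : {v | Wins β γ (rotate U E).1 (S.play ω (rotate U E) v)} ⊆
      ⋃ j : Fin J, ⋃ s : Fin M → Bool,
        Function.eval j ⁻¹' {w | Wins β γ (rotate U E).1 (S.reply ω s w)} := by
    intro v hv
    set E' := rotate U E
    have h : S.reply ω (S.message (ω, E', v)) (v (S.index (ω, E', v))) = S.play ω E' v := rfl
    refine Set.mem_iUnion₂.2 ⟨S.index (ω, E', v), S.message (ω, E', v), ?_⟩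
    rw [Set.mem_preimage, Function.eval, Set.mem_ofPred_eq, h]
    exact hv
  refine (measure_mono hsub).trans ((measure_iUnion_fintype_le _ _).trans
    (Finset.sum_le_sum fun j _ => (measure_iUnion_fintype_le _ _).trans
      (Finset.sum_le_sum fun s _ => ?_)))
  rw [← pi_uniformSphere_rotate_wins hn β γ U E (S.measurable_reply ω s)]
  exact ((measurePreserving_eval (fun _ : Fin J => Measure.pi fun _ : Fin m =>
    uniformSphere (rotate U E).1) j).measure_preimage
      (measurableSet_setOf_wins β γ U E (S.measurable_reply ω s)).nullMeasurableSet).le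

lemma Strategy.lintegral_pi_wins_le {Ω : Type*} [MeasurableSpace Ω] {d n M k m J : ℕ}
    (S : Strategy Ω d n M k m J) (ω : Ω) {β γ : ℝ}
    (hβ : 0 < β) (hγ : 0 < γ) (hn : 1 ≤ n) (hnd : n ≤ d)
    (hm : (m : ℝ) ≤ (n : ℝ) / 2) (hkn : (k : ℝ) ≤ (n : ℝ) / 4)
    (hγβ : 3 * Real.exp 1 * Real.sqrt ((k : ℝ) * d / n) ≤ γ / β) :
    ∫⁻ E : Gr d n, Measure.pi (fun _ : Fin J => Measure.pi fun _ : Fin m => uniformSphere E.1)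
        {v | Wins β γ E.1 (S.play ω E v)} ∂(uniformGr d n hnd) ≤
      J * (2 ^ M * ENNReal.ofReal ((1 / 2 : ℝ) ^ ((n : ℝ) / 8)) ^ k) := by
  set E₀ := coordSubspace d n hnd
  have := isProbabilityMeasure_uniformSphere hn E₀
  have hmeas : ∀ s : Fin M → Bool, Measurable fun U : OrthGroup d =>
      Measure.pi (fun _ : Fin m => uniformSphere E₀.1)
        (Prod.mk U ⁻¹' winSet β γ E₀.1 (S.reply ω s)) := fun s =>
    measurable_measure_prodMk_left (measurableSet_winSet β γ E₀.1 (S.measurable_reply ω s))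
  -- Only this inequality is needed, so the integrand need not be measurable in `E`.
  refine (lintegral_map_le _ _).trans
    ((lintegral_mono fun U => S.pi_wins_le ω hn β γ U E₀).trans ?_)
  rw [lintegral_finsetSum _ fun j _ => Finset.measurable_sum _ fun s _ => hmeas s]
  simp_rw [lintegral_finsetSum _ fun s _ => hmeas s]
  refine (Finset.sum_le_sum fun j _ => Finset.sum_le_sum fun s _ =>
    lintegral_pi_winSet_le (S.measurable_reply ω s) hβ hγ hn hnd E₀ hm hkn hγβ).trans ?_
  simp

lemma Strategy.winProb_le {Ω : Type*} [MeasurableSpace Ω] {d n M k m J : ℕ}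
    (S : Strategy Ω d n M k m J) (ρ : Measure Ω) [IsProbabilityMeasure ρ] {β γ : ℝ}
    (hβ : 0 < β) (hγ : 0 < γ) (hn : 1 ≤ n) (hnd : n ≤ d)
    (hm : (m : ℝ) ≤ (n : ℝ) / 2) (hkn : (k : ℝ) ≤ (n : ℝ) / 4)
    (hγβ : 3 * Real.exp 1 * Real.sqrt ((k : ℝ) * d / n) ≤ γ / β) :
    S.winProb ρ hnd β γ ≤
      J * (2 ^ M * ENNReal.ofReal ((1 / 2 : ℝ) ^ ((n : ℝ) / 8)) ^ k) := by
  refine (lintegral_mono fun ω =>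
    S.lintegral_pi_wins_le ω hβ hγ hn hnd hm hkn hγβ).trans ?_
  simp

/-- In base-two logarithms the claim is `M + log J + log C < n k / 8`. The logarithmic factor in the
hypothesis enters only through the lower bound `1 / 2`, which follows from `d ≥ 8 > e` and `γ ≤ 1`.
-/
lemma mul_two_pow_mul_lt {d n M k J : ℕ} {C γ : ℝ}
    (hd : 8 ≤ d) (hn : 1 ≤ n) (hJ : 1 ≤ J) (hC : 1 ≤ C) (hγ : 0 < γ) (hγ1 : γ ≤ 1)
    (hk : 50 * C * (((M : ℝ) + 2 * Real.logb 2 J + 3) / n) * Real.log (Real.sqrt d / γ)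
      ≤ (k : ℝ)) :
    (J : ℝ) * (2 ^ M * ((1 / 2 : ℝ) ^ ((n : ℝ) / 8)) ^ k) < 1 / C := by
  have hn0 : (0 : ℝ) < n := by exact_mod_cast hn
  have hJ1 : (1 : ℝ) ≤ J := by exact_mod_cast hJ
  have hC0 : 0 < C := by linarith
  have hd8 : (8 : ℝ) ≤ d := by exact_mod_cast hd
  have hlogJ : 0 ≤ Real.logb 2 J := Real.logb_nonneg (by norm_num) hJ1
  have hM : (0 : ℝ) ≤ M := Nat.cast_nonneg M
  have hlog : 1 / 2 ≤ Real.log (Real.sqrt d / γ) := by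
    have h1 : Real.log (Real.sqrt d) ≤ Real.log (Real.sqrt d / γ) := by
      refine Real.log_le_log (Real.sqrt_pos.2 (by linarith)) ?_
      rw [le_div_iff₀ hγ]
      exact mul_le_of_le_one_right (Real.sqrt_nonneg _) hγ1
    have h2 : 1 ≤ Real.log d := by
      rw [Real.le_log_iff_exp_le (by linarith)]
      linarith [Real.exp_one_lt_d9]
    rw [Real.log_sqrt (by linarith)] at h1
    linarith
  have hkn : 25 * (C * (M + 2 * Real.logb 2 J + 3)) ≤ k * n := by
    have h1 : 50 * C * (((M : ℝ) + 2 * Real.logb 2 J + 3) / n) * (1 / 2) ≤ k := by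
      refine le_trans ?_ hk
      gcongr
    rw [← div_le_iff₀ hn0]
    refine le_trans (le_of_eq ?_) h1
    ring
  have hlogC : Real.logb 2 C ≤ 2 * C := by
    have h1 := Real.log_le_sub_one_of_pos hC0
    have h2 := Real.log_two_gt_d9
    rw [Real.logb, div_le_iff₀ (by linarith)]
    nlinarith
  -- As `C ≥ 1`, the bound `25 C (M + 2 log J + 3) / 8` dominates `M + log J`, and its constant term
  -- leaves more than `2 C` for `log C`.
  have hexp : M + Real.logb 2 J + Real.logb 2 C < n / 8 * k := by nlinarith
  have h2 : ((1 / 2 : ℝ) ^ ((n : ℝ) / 8)) ^ k = 2 ^ (-((n : ℝ) / 8 * k)) := by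
    rw [← Real.rpow_natCast, ← Real.rpow_mul (by norm_num), one_div, Real.inv_rpow (by norm_num),
      Real.rpow_neg (by norm_num)]
  have hJ2 : (J : ℝ) = 2 ^ Real.logb 2 (J : ℝ) :=
    (Real.rpow_logb (by norm_num) (by norm_num) (by linarith)).symm
  have hC2 : 1 / C = 2 ^ (-Real.logb 2 C) := by
    rw [Real.rpow_neg (by norm_num), Real.rpow_logb (by norm_num) (by norm_num) hC0, one_div]
  rw [h2, hC2, ← Real.rpow_natCast 2 M]
  nth_rw 1 [hJ2]
  rw [← Real.rpow_add (by norm_num), ← Real.rpow_add (by norm_num)]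
  exact Real.rpow_lt_rpow_of_exponent_lt (by norm_num) (by linarith)

end OrthogonalSubspaceGame

end

theorem mainTheorem7
    (d n M k m J : ℕ) (C β γ : ℝ)
    (hd : 8 ≤ d) (hn : 1 ≤ n) (hnd : n ≤ d) (hJ : 1 ≤ J) (hC : 1 ≤ C)
    (hβ : 0 < β) (hβ1 : β ≤ 1) (hγ : 0 < γ) (hγ1 : γ ≤ 1)
    (hγβ : 3 * Real.exp 1 * Real.sqrt ((k : ℝ) * d / n) ≤ γ / β)
    (hkn : (k : ℝ) ≤ (n : ℝ) / 4)
    (hk : 50 * C * (((M : ℝ) + 2 * Real.logb 2 J + 3) / n) * Real.log (Real.sqrt d / γ) ≤ (k : ℝ))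
    {Ω : Type*} [MeasurableSpace Ω] (ρ : MeasureTheory.Measure Ω)
    [MeasureTheory.IsProbabilityMeasure ρ]
    (S : OrthogonalSubspaceGame.Strategy Ω d n M k m J)
    (hwin : ENNReal.ofReal (1 / C) ≤ S.winProb ρ hnd β γ) :
    (n : ℝ) / 2 < (m : ℝ) := by 
  by_contra hmn
  have hle := S.winProb_le ρ hβ hγ hn hnd (not_lt.1 hmn) hkn hγβ
  have hlt := OrthogonalSubspaceGame.mul_two_pow_mul_lt hd hn hJ hC hγ hγ1 hk
  refine (hwin.trans hle).not_gt ?_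
  have hr : (J : ENNReal) * (2 ^ M * ENNReal.ofReal ((1 / 2 : ℝ) ^ ((n : ℝ) / 8)) ^ k)
      = ENNReal.ofReal ((J : ℝ) * (2 ^ M * ((1 / 2 : ℝ) ^ ((n : ℝ) / 8)) ^ k)) := by
    rw [ENNReal.ofReal_mul (by positivity), ENNReal.ofReal_mul (by positivity),
      ENNReal.ofReal_pow (by positivity), ENNReal.ofReal_pow (by positivity),
      ENNReal.ofReal_natCast, ENNReal.ofReal_ofNat]
  rw [hr]
  exact (ENNReal.ofReal_lt_ofReal_iff (by positivity)).2 hlt
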